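/- Let $p$ be a prime, let $\mathbb{K}\subset\mathbb{C}_p$ be a finite extension of $\mathbb{Q}_p$ with algebraic closure $\overline{\mathbb{K}}\subset\mathbb{C}_p$, and let $f\in\mathbb{K}[x]$ be a squarefree polynomial of degree $d\ge 3$. Let $X$ be the smooth proper (hyperelliptic) curve over $\mathbb{K}$ given by $y^2=f(x)$, and put $$\omega_i=x^i\,\frac{dx}{2y}\quad(i\ge 0),\qquad \nu_\beta=\frac{1}{x-\beta}\,\frac{dx}{2y}\quad(\beta\in\overline{\mathbb{K}}).$$ The computation of Berkovich–Coleman integrals of meromorphic $1$-forms on $X$ reduces to that of the integrals of $\omega_0,\dots,\omega_{d-2}$ and of the $\nu_\beta$ with $f(\beta)\ne0$, in the following sense. For every meromorphic $1$-form $\omega$ on $X$ over $\mathbb{K}$ there are a rational function $F\in\overline{\mathbb{K}}(X)$, finitely many $h_k\in\overline{\mathbb{K}}(X)^\times$ and $c_k\in\overline{\mathbb{K}}$, constants $e_0,\dots,e_{d-2}\in\overline{\mathbb{K}}$, and finitely many $\beta_j\in\overline{\mathbb{K}}$ with $f(\beta_j)\neq 0$ and $b_j\in\overline{\mathbb{K}}$,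 such that $$\omega=dF+\sum_k c_k\frac{dh_k}{h_k}+\sum_{i=0}^{d-2}e_i\,\omega_i+\sum_j b_j\,\nu_{\beta_j},$$ and such that, consequently, for every branch $\operatorname{Log}$ of the $p$-adic logarithm, every open subset $U$ of the Berkovich analytification $X^{\mathrm{an}}$ over $\mathbb{C}_p$ on which $F$ has no poles, the $h_k$ have neither zeros nor poles, and the $\nu_{\beta_j}$ and the $\omega_i$ with $e_i\ne0$ are regular, and every path $\gamma$ in $U$ with ends $P=\gamma(0)$ and $Q=\gamma(1)$ in $U(\mathbb{C}_p)$, $$\int_\gamma\omega=F(Q)-F(P)+\sum_k c_k\operatorname{Log}\frac{h_k(Q)}{h_k(P)}+\sum_{i=0}^{d-2}e_i\int_\gamma\omega_i+\sum_j b_j\int_\gamma\nu_{\beta_j},$$ where the terms with $e_i=0$ are read as $0$. Here $\int$ is the Berkovich–Coleman integral with respect to $\operatorname{Log}$. On curves, this is the integral of analytic $1$-forms on open subsets $U$ of Berkovich curves over $\mathbb{C}_p$ along paths in $U$ with ends in $U(\mathbb{C}_p)$ that is characterized by linearity in the form, additivity under concatenation of paths, invariance under homotopies with fixed ends, the formulas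 $\int_\gamma da=a(\gamma(1))-a(\gamma(0))$ and $\int_\gamma \frac{da}{a}=\operatorname{Log}\frac{a(\gamma(1))}{a(\gamma(0))}$ for rational functions $a$ without poles on $U$ (respectively without zeros and poles on $U$), and functoriality $\int_\gamma \varphi^*\eta=\int_{\varphi\circ\gamma}\eta$ for analytic morphisms $\varphi$. -/

import Mathlib

open scoped ENNReal Topology KaehlerDifferential
open TopologicalSpace

universe u

/-! ### Berkovich curves

Throughout `k` is a valued field (later `ℂ_[p]`) and `F` is the function field of a smooth proper
curve `X` over `k`.  -/

/-- `F` is an algebraic function field in one variable over `k`, i.e. the function field of a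
(unique) smooth proper curve over `k`. -/
def IsCurveFunctionField (k F : Type*) [Field k] [Field F] [Algebra k F] : Prop :=
  ∃ x : F, Transcendental k x ∧ FiniteDimensional (IntermediateField.adjoin k {x}) F

/-- The points of the Berkovich analytification `X^an` of the smooth proper curve `X` with function
field `F`: a point `v` is given by the values `|a(v)| ∈ [0, ∞]` of all rational functions `a` on `X`,
the value `∞` meaning that `a` has a pole at `v`.  Thus `v` is a multiplicative ultrametric
`[0, ∞]`-valued seminorm on `F` that extends the absolute value of `k`.  Such a `v` is either an
honest absolute value on `F` (the points of types II, III, IV), or takes the value `∞`, and then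
`v a = |a(P)|` for a closed point `P` of `X` (a point of type I, if `k` is algebraically closed). -/
@[ext]
structure BerkPoint (k F : Type*) [NormedField k] [Field F] [Algebra k F] where
  /-- the value `|a(v)|` -/
  val : F → ℝ≥0∞
  val_algebraMap : ∀ c : k, val (algebraMap k F c) = ‖c‖ₑ
  val_add_le : ∀ a b : F, val (a + b) ≤ max (val a) (val b)
  val_mul : ∀ a b : F, val a < ∞ → val b < ∞ → val (a * b) = val a * val b
  val_inv : ∀ a : F, a ≠ 0 → val a⁻¹ = (val a)⁻¹

/-- The topology of `X^an`: the coarsest one for which `v ↦ |a(v)| ∈ [0, ∞]` is continuous for every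
rational function `a`. -/
instance BerkPoint.instTopologicalSpace (k F : Type*) [NormedField k] [Field F] [Algebra k F] :
    TopologicalSpace (BerkPoint k F) :=
  TopologicalSpace.induced BerkPoint.val inferInstance

namespace BerkPoint

variable {k F : Type*} [NormedField k] [Field F] [Algebra k F]

/-- `v` is a point of `X(k)`: every rational function without a pole at `v` has a value in `k`. -/
def IsRational (v : BerkPoint k F) : Prop :=
  ∀ a : F, v.val a < ∞ → ∃ c : k, v.val (a - algebraMap k F c) = 0

open Classical in
/-- The value `a(P) ∈ k` of a rational function `a` at a point `P ∈ X(k)` that is not a pole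
of `a` (and `0` otherwise). -/
noncomputable def eval (P : BerkPoint k F) (a : F) : k :=
  if h : ∃ c : k, P.val (a - algebraMap k F c) = 0 then h.choose else 0

/-- The rational `1`-forms on `X` that are regular at `v`: the forms `∑ aᵢ dtᵢ` with rational
functions `aᵢ`, `tᵢ` that have no pole at `v`. -/
noncomputable def regularForms (v : BerkPoint k F) : Submodule k (Ω[F⁄k]) :=
  Submodule.span k {η | ∃ a t : F, v.val a < ∞ ∧ v.val t < ∞ ∧ η = a • KaehlerDifferential.D k F t}

/-- The rational `1`-forms on `X` that vanish at `v`: the forms `∑ aᵢ dtᵢ` with rational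
functions `aᵢ`, `tᵢ` that have no pole at `v`, and with `aᵢ(v) = 0`. -/
noncomputable def vanishingForms (v : BerkPoint k F) : Submodule k (Ω[F⁄k]) :=
  Submodule.span k {η | ∃ a t : F, v.val a = 0 ∧ v.val t < ∞ ∧ η = a • KaehlerDifferential.D k F t}

/-- The space in which values at `v` of `1`-forms lie; for `v ∈ X(k)` it contains the cotangent line
`regularForms v / vanishingForms v` of `X` at `v`. -/
abbrev FormValue (v : BerkPoint k F) : Type _ := (Ω[F⁄k]) ⧸ v.vanishingForms

/-- The value at `v` of a rational `1`-form. -/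
noncomputable abbrev formValue (v : BerkPoint k F) : (Ω[F⁄k]) →ₗ[k] v.FormValue :=
  v.vanishingForms.mkQ

lemma isOpen_lt_top (a : F) : IsOpen {v : BerkPoint k F | v.val a < ∞} := by
  have : Continuous (fun v : BerkPoint k F => v.val a) :=
    (continuous_apply a).comp continuous_induced_dom
  exact isOpen_lt this continuous_const

end BerkPoint

/-! ### Analytic functions, analytic forms and morphisms

Analytic functions and forms on an open subset `U` of `X^an` are described by their values at the
points of `U(k)`; for `k = ℂ_[p]` these are dense in `U`.  -/

section Analytic

variable {k F : Type*} [NormedField k] [Field F] [Algebra k F]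

/-- The function `g` on `U` (of which only the values on `U(k)` matter) is analytic at `x`: on some
neighbourhood of `x` it is a uniform limit of rational functions without poles there. -/
def IsAnalyticAt {U : Opens (BerkPoint k F)} (g : U → k) (x : U) : Prop :=
  ∃ V ∈ 𝓝 x, ∀ ε : ℝ≥0∞, 0 < ε → ∃ r : F, ∀ z ∈ V, z.1.val r < ∞ ∧
    (z.1.IsRational → z.1.val (r - algebraMap k F (g z)) ≤ ε)

/-- The set `U(k)`. -/
abbrev RationalPoint (U : Opens (BerkPoint k F)) : Type _ := {P : U // P.1.IsRational}

/-- The `k`-vector space of analytic `1`-forms on the open subset `U` of `X^an`: families of cotangent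
vectors that are locally of the form `∑ gᵢ dtᵢ` with analytic functions `gᵢ` and rational functions
`tᵢ` without poles.  (As `X` is a curve, all of them are closed.) -/
noncomputable def analyticForms (U : Opens (BerkPoint k F)) :
    Submodule k (∀ P : RationalPoint U, P.1.1.FormValue) where
  carrier := {w | ∀ x : U, ∃ V ∈ 𝓝 x, ∃ (n : ℕ) (g : Fin n → U → k) (t : Fin n → F),
    (∀ i, ∀ z ∈ V, z.1.val (t i) < ∞ ∧ IsAnalyticAt (g i) z) ∧
    ∀ P : RationalPoint U, P.1 ∈ V →
      w P = ∑ i, g i P.1 • P.1.1.formValue (KaehlerDifferential.D k F (t i))}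
  zero_mem' := fun x => ⟨Set.univ, Filter.univ_mem, 0, Fin.elim0, Fin.elim0,
    fun i => i.elim0, fun P _ => by simp⟩
  add_mem' := by
    intro w₁ w₂ h₁ h₂ x
    obtain ⟨V₁, hV₁, n₁, g₁, t₁, hr₁, he₁⟩ := h₁ x
    obtain ⟨V₂, hV₂, n₂, g₂, t₂, hr₂, he₂⟩ := h₂ x
    refine ⟨V₁ ∩ V₂, Filter.inter_mem hV₁ hV₂, n₁ + n₂, Fin.append g₁ g₂, Fin.append t₁ t₂, ?_, ?_⟩
    · intro i
      refine Fin.addCases (fun j => ?_) (fun j => ?_) i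
      · intro z hz
        simpa using hr₁ j z hz.1
      · intro z hz
        simpa using hr₂ j z hz.2
    · intro P hP
      rw [Pi.add_apply, he₁ P hP.1, he₂ P hP.2, Fin.sum_univ_add]
      simp
  smul_mem' := by
    intro c w h x
    obtain ⟨V, hV, n, g, t, hr, he⟩ := h x
    refine ⟨V, hV, n, g, fun i => algebraMap k F c * t i, ?_, ?_⟩
    · intro i z hz
      refine ⟨?_, (hr i z hz).2⟩
      have hc : z.1.val (algebraMap k F c) < ∞ := by
        rw [z.1.val_algebraMap]; exact enorm_lt_top
      rw [z.1.val_mul _ _ hc (hr i z hz).1]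
      exact ENNReal.mul_lt_top hc (hr i z hz).1
    · intro P hP
      rw [Pi.smul_apply, he P hP, Finset.smul_sum]
      refine Finset.sum_congr rfl fun i _ => ?_
      simp only [← Algebra.smul_def, Derivation.map_smul, map_smul]
      rw [smul_comm]

/-- The rational `1`-form `η` is regular on `U`. -/
def IsRegularOn (U : Opens (BerkPoint k F)) (η : Ω[F⁄k]) : Prop :=
  ∀ v ∈ U, η ∈ v.regularForms

/-- The rational function `a` has no pole on `U`. -/
def HasNoPoleOn (U : Opens (BerkPoint k F)) (a : F) : Prop :=
  ∀ v ∈ U, v.val a < ∞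

/-- The rational function `a` has neither zeros nor poles on `U`. -/
def IsUnitOn (U : Opens (BerkPoint k F)) (a : F) : Prop :=
  ∀ v ∈ U, v.val a ≠ 0 ∧ v.val a < ∞

lemma isAnalyticAt_eval {U : Opens (BerkPoint k F)} (a : F) (x : U) (hx : x.1.val a < ∞) :
    IsAnalyticAt (fun z : U => z.1.eval a) x := by
  refine ⟨{z : U | z.1.val a < ∞}, ?_, fun ε _ => ⟨a, fun z hz => ⟨hz, fun hz' => ?_⟩⟩⟩
  · exact ((BerkPoint.isOpen_lt_top a).preimage continuous_subtype_val).mem_nhds hx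
  · have h := hz' a hz
    have : z.1.val (a - algebraMap k F (z.1.eval a)) = 0 := by
      unfold BerkPoint.eval
      rw [dif_pos h]
      exact h.choose_spec
    rw [this]
    exact zero_le

/-- A rational `1`-form that is regular on `U` is an analytic `1`-form on `U`. -/
lemma formValue_mem_analyticForms (U : Opens (BerkPoint k F)) (η : Ω[F⁄k]) (hη : IsRegularOn U η) :
    (fun P : RationalPoint U => P.1.1.formValue η) ∈ analyticForms U := by
  intro x
  have key : ∀ η ∈ x.1.regularForms, ∃ V ∈ 𝓝 x, ∃ (n : ℕ) (g : Fin n → U → k) (t : Fin n → F),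
      (∀ i, ∀ z ∈ V, z.1.val (t i) < ∞ ∧ IsAnalyticAt (g i) z) ∧
      ∀ P : RationalPoint U, P.1 ∈ V →
        P.1.1.formValue η =
          ∑ i, g i P.1 • P.1.1.formValue (KaehlerDifferential.D k F (t i)) := by
    intro η hη
    refine Submodule.span_induction ?_ ?_ ?_ ?_ hη
    · rintro _ ⟨a, t, ha, ht, rfl⟩
      refine ⟨{z : U | z.1.val a < ∞} ∩ {z : U | z.1.val t < ∞}, Filter.inter_mem ?_ ?_, 1,
        fun _ z => z.1.eval a, fun _ => t, ?_, ?_⟩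
      · exact ((BerkPoint.isOpen_lt_top a).preimage continuous_subtype_val).mem_nhds ha
      · exact ((BerkPoint.isOpen_lt_top t).preimage continuous_subtype_val).mem_nhds ht
      · intro i z hz
        exact ⟨hz.2, isAnalyticAt_eval a z hz.1⟩
      · intro P hP
        have h := P.2 a hP.1
        have h0 : P.1.1.val (a - algebraMap k F (P.1.1.eval a)) = 0 := by
          unfold BerkPoint.eval
          rw [dif_pos h]
          exact h.choose_spec
        simp only [Finset.univ_unique, Finset.sum_singleton]
        rw [← LinearMap.map_smul, ← sub_eq_zero, ← map_sub, Submodule.mkQ_apply,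
          Submodule.Quotient.mk_eq_zero]
        refine Submodule.subset_span ⟨_, t, h0, hP.2, ?_⟩
        rw [sub_smul, algebraMap_smul]
    · exact ⟨Set.univ, Filter.univ_mem, 0, Fin.elim0, Fin.elim0, fun i => i.elim0,
        fun P _ => by simp⟩
    · rintro η₁ η₂ - - ⟨V₁, hV₁, n₁, g₁, t₁, hr₁, he₁⟩ ⟨V₂, hV₂, n₂, g₂, t₂, hr₂, he₂⟩
      refine ⟨V₁ ∩ V₂, Filter.inter_mem hV₁ hV₂, n₁ + n₂, Fin.append g₁ g₂, Fin.append t₁ t₂,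
        ?_, ?_⟩
      · intro i
        refine Fin.addCases (fun j => ?_) (fun j => ?_) i
        · intro z hz
          simpa using hr₁ j z hz.1
        · intro z hz
          simpa using hr₂ j z hz.2
      · intro P hP
        rw [map_add, he₁ P hP.1, he₂ P hP.2, Fin.sum_univ_add]
        simp
    · rintro c η - ⟨V, hV, n, g, t, hr, he⟩
      refine ⟨V, hV, n, g, fun i => algebraMap k F c * t i, ?_, ?_⟩
      · intro i z hz
        refine ⟨?_, (hr i z hz).2⟩
        have hc : z.1.val (algebraMap k F c) < ∞ := by
          rw [z.1.val_algebraMap]; exact enorm_lt_top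
        rw [z.1.val_mul _ _ hc (hr i z hz).1]
        exact ENNReal.mul_lt_top hc (hr i z hz).1
      · intro P hP
        rw [map_smul, he P hP, Finset.smul_sum]
        refine Finset.sum_congr rfl fun i _ => ?_
        simp only [← Algebra.smul_def, Derivation.map_smul, map_smul]
        rw [smul_comm]
  exact key η (hη x.1 x.2)

/-- The analytic `1`-form on `U` given by a rational `1`-form that is regular on `U`. -/
noncomputable def restrictForm (U : Opens (BerkPoint k F)) (η : Ω[F⁄k]) (hη : IsRegularOn U η) :
    analyticForms U :=
  ⟨fun P => P.1.1.formValue η, formValue_mem_analyticForms U η hη⟩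

/-- A morphism of `k`-analytic curves `U → V`, where `U` and `V` are open subsets of Berkovich curves:
a continuous map that sends `U(k)` to `V(k)` and pulls back analytic functions to analytic functions.
(Analytic functions being local uniform limits of rational ones, it is enough to pull back
the latter.) -/
structure AnalyticMorphism {G : Type*} [Field G] [Algebra k G]
    (U : Opens (BerkPoint k F)) (V : Opens (BerkPoint k G)) where
  /-- the underlying map -/
  toMap : C(U, V)
  map_isRational : ∀ P : U, P.1.IsRational → (toMap P).1.IsRational
  analytic : ∀ (s : G) (x : U), (toMap x).1.val s < ∞ →
    IsAnalyticAt (fun z => (toMap z).1.eval s) x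

/-- `w' = h^* w` for analytic forms `w` on `V` and `w'` on `U` and a morphism `h : U → V`: at every
point `P ∈ U(k)` there are rational functions `s`, `r` with `w(h(P)) = ds`, `w'(P) = dr`, such that the
analytic function `s ∘ h - r` minus its value at `P` vanishes to order at least two at `P`. -/
def IsPullback {G : Type*} [Field G] [Algebra k G]
    {U : Opens (BerkPoint k F)} {V : Opens (BerkPoint k G)} (h : AnalyticMorphism U V)
    (w : analyticForms V) (w' : analyticForms U) : Prop :=
  ∀ P : RationalPoint U, ∃ (s : G) (r : F),
    (h.toMap P.1).1.val s < ∞ ∧ P.1.1.val r < ∞ ∧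
    w.1 ⟨h.toMap P.1, h.map_isRational P.1 P.2⟩ =
      (h.toMap P.1).1.formValue (KaehlerDifferential.D k G s) ∧
    w'.1 P = P.1.1.formValue (KaehlerDifferential.D k F r) ∧
    ∃ (u : F) (M : ℝ), P.1.1.val u = 0 ∧ ∀ᶠ Q : U in 𝓝 P.1, Q.1.IsRational →
      ‖((h.toMap Q).1.eval s - (h.toMap P.1).1.eval s) - (Q.1.eval r - P.1.1.eval r)‖ ≤
        M * ‖Q.1.eval u‖ ^ 2

end Analytic

/-! ### The Berkovich–Coleman integral -/

/-- A branch of the `p`-adic logarithm: a homomorphism from the multiplicative group of `ℂ_[p]` to its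
additive group that is given by the Mercator series on `1 + z` for `‖z‖ < 1`. -/
structure LogBranch (p : ℕ) [Fact p.Prime] where
  /-- the function; its value at `0` is irrelevant -/
  log : ℂ_[p] → ℂ_[p]
  log_mul : ∀ a b : ℂ_[p], a ≠ 0 → b ≠ 0 → log (a * b) = log a + log b
  log_one_add : ∀ z : ℂ_[p], ‖z‖ < 1 →
    HasSum (fun n : ℕ => (-1) ^ n * z ^ (n + 1) / ((n : ℂ_[p]) + 1)) (log (1 + z))

/-- A Berkovich–Coleman integration on curves over `ℂ_[p]`, with respect to a branch of the logarithm: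
a rule that assigns a number to every analytic `1`-form on an open subset `U` of a Berkovich curve and
every path in `U` with ends in `U(ℂ_[p])`, and that has the properties by which this integral is
defined: linearity, additivity in the path, invariance under homotopy with fixed ends,
the fundamental theorem for exact and for logarithmic differentials, functoriality. -/
structure BerkovichColemanIntegration (p : ℕ) [Fact p.Prime] (ℓ : LogBranch p) where
  /-- the integral of the form along the path; only its values for function fields `F` and for
  paths with ends in `U(ℂ_[p])` are meaningful -/
  integral : ∀ {F : Type u} [Field F] [Algebra ℂ_[p] F] {U : Opens (BerkPoint ℂ_[p] F)} {x y : U},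
    Path x y → analyticForms U → ℂ_[p]
  integral_linear : ∀ {F : Type u} [Field F] [Algebra ℂ_[p] F]
    {U : Opens (BerkPoint ℂ_[p] F)} {x y : U} (γ : Path x y) (w₁ w₂ : analyticForms U)
    (c₁ c₂ : ℂ_[p]), IsCurveFunctionField ℂ_[p] F → x.1.IsRational → y.1.IsRational →
    integral γ (c₁ • w₁ + c₂ • w₂) = c₁ * integral γ w₁ + c₂ * integral γ w₂
  integral_trans : ∀ {F : Type u} [Field F] [Algebra ℂ_[p] F]
    {U : Opens (BerkPoint ℂ_[p] F)} {x y z : U} (γ₁ : Path x y) (γ₂ : Path y z)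
    (w : analyticForms U), IsCurveFunctionField ℂ_[p] F →
    x.1.IsRational → y.1.IsRational → z.1.IsRational →
    integral (γ₁.trans γ₂) w = integral γ₁ w + integral γ₂ w
  integral_homotopic : ∀ {F : Type u} [Field F] [Algebra ℂ_[p] F]
    {U : Opens (BerkPoint ℂ_[p] F)} {x y : U} (γ₁ γ₂ : Path x y) (w : analyticForms U),
    IsCurveFunctionField ℂ_[p] F → x.1.IsRational → y.1.IsRational →
    γ₁.Homotopic γ₂ → integral γ₁ w = integral γ₂ w
  integral_exact : ∀ {F : Type u} [Field F] [Algebra ℂ_[p] F]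
    {U : Opens (BerkPoint ℂ_[p] F)} {x y : U} (γ : Path x y) (a : F)
    (h : IsRegularOn U (KaehlerDifferential.D ℂ_[p] F a)),
    IsCurveFunctionField ℂ_[p] F → x.1.IsRational → y.1.IsRational → HasNoPoleOn U a →
    integral γ (restrictForm U (KaehlerDifferential.D ℂ_[p] F a) h) = y.1.eval a - x.1.eval a
  integral_logarithmic : ∀ {F : Type u} [Field F] [Algebra ℂ_[p] F]
    {U : Opens (BerkPoint ℂ_[p] F)} {x y : U} (γ : Path x y) (a : F)
    (h : IsRegularOn U (a⁻¹ • KaehlerDifferential.D ℂ_[p] F a)),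
    IsCurveFunctionField ℂ_[p] F → x.1.IsRational → y.1.IsRational → IsUnitOn U a →
    integral γ (restrictForm U (a⁻¹ • KaehlerDifferential.D ℂ_[p] F a) h) =
      ℓ.log (y.1.eval a / x.1.eval a)
  integral_pullback : ∀ {F G : Type u} [Field F] [Algebra ℂ_[p] F] [Field G] [Algebra ℂ_[p] G]
    {U : Opens (BerkPoint ℂ_[p] F)} {V : Opens (BerkPoint ℂ_[p] G)} (h : AnalyticMorphism U V)
    {x y : U} (γ : Path x y) (w : analyticForms V) (w' : analyticForms U),
    IsCurveFunctionField ℂ_[p] F → IsCurveFunctionField ℂ_[p] G →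
    x.1.IsRational → y.1.IsRational → IsPullback h w w' →
    integral γ w' = integral (γ.map h.toMap.continuous) w

open Classical in
/-- The Berkovich–Coleman integral of a meromorphic (i.e. rational) `1`-form along a path in an open
set on which the form is regular (and `0` if the form is not regular there). -/
noncomputable def BerkovichColemanIntegration.meromorphicIntegral {p : ℕ} [Fact p.Prime]
    {ℓ : LogBranch p} (I : BerkovichColemanIntegration.{u} p ℓ) {F : Type u} [Field F]
    [Algebra ℂ_[p] F] {U : Opens (BerkPoint ℂ_[p] F)} {x y : U} (γ : Path x y)
    (η : Ω[F⁄ℂ_[p]]) : ℂ_[p] :=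
  if h : IsRegularOn U η then I.integral γ (restrictForm U η h) else 0

/-! ### Hyperelliptic curves -/

/-- `L` is the function field of the curve `y² = f(x)` over `k`, with coordinate functions `x`, `y`. -/
structure IsHyperellipticFunctionField {k L : Type*} [Field k] [Field L] [Algebra k L]
    (f : Polynomial k) (x y : L) : Prop where
  transcendental : Transcendental k x
  equation : y ^ 2 = Polynomial.aeval x f
  generate : IntermediateField.adjoin k {x, y} = ⊤

/-- The field `K(X) = K(x, y)` of rational functions on the curve that are defined over the
subfield `K` of `k`. -/
def rationalFunctionsOver {k L : Type*} [Field k] [Field L] [Algebra k L] (K : Subfield k)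
    (x y : L) : Subfield L :=
  Subfield.closure (algebraMap k L '' (K : Set k) ∪ {x, y})

/-- The meromorphic `1`-forms on the curve that are defined over the subfield `K` of `k`: the sums
`∑ aᵢ dbᵢ` with `aᵢ, bᵢ ∈ K(X)`. -/
noncomputable def meromorphicFormsOver {k L : Type*} [Field k] [Field L] [Algebra k L] (K : Subfield k)
    (x y : L) : AddSubgroup (Ω[L⁄k]) :=
  AddSubgroup.closure {η | ∃ a ∈ rationalFunctionsOver K x y, ∃ b ∈ rationalFunctionsOver K x y,
    η = a • KaehlerDifferential.D k L b}

/-- The form `ω_i = x^i dx / (2y)`. -/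
noncomputable def omegaForm (k : Type*) {L : Type*} [Field k] [Field L] [Algebra k L] (x y : L)
    (i : ℕ) : Ω[L⁄k] :=
  (x ^ i / (2 * y)) • KaehlerDifferential.D k L x

/-- The form `ν_β = (1 / (x - β)) dx / (2y)`. -/
noncomputable def nuForm {k L : Type*} [Field k] [Field L] [Algebra k L] (x y : L) (β : k) :
    Ω[L⁄k] :=
  ((x - algebraMap k L β)⁻¹ / (2 * y)) • KaehlerDifferential.D k L x

/-! Over an algebraically closed field `K` of characteristic zero (in the end the closure of ℚ_p in
ℂ_p), the functions on the curve are `r + s y` with `r, s ∈ K(x)`, and `dy` is a multiple of `dx`.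
So every form is `r dx + s dx/(2y)` with `r, s ∈ K(x)`, and by partial fractions `r` and `s` may be
taken to be `Q(x)/(x - α)^m`.

The part `r dx` is elementary: each term integrates to a rational function, except `dx/(x - α)`,
which is logarithmic. The part `s dx/(2y)` is reduced modulo the exact forms `d(r y) = (r f' + 2 r'
f) dx/(2y)`. For `r = x^j` the coefficient has degree exactly `j + deg f - 1`, which removes all
powers of `x` from `deg f - 1` on (`aeval_smul_mem`). For `r = (x - α)^(-m)` and `f(α) ≠ 0` the pole
order is exactly `m + 1`, which removes all poles but simple ones. If `f(α) = 0`, one factor `x - α`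
of `f` cancels, the order is exactly `m` since `f` is squarefree, and even simple poles disappear
(`singlePoleFraction_smul_mem_of_sq_eq`).

The reductions are stated as membership in a subspace `W` that contains the allowed forms.
Coefficients are read off only at the end, from a sum of four subspaces. The formula for integrals
then follows term by term, by linearity and the formulas for `da` and `da/a`. -/

/-! ### Partial fractions -/

section PartialFractions

open Polynomial

variable {K L : Type*} [Field K] [Field L] [Algebra K L] {x : L}

/-- The fractions `Q(x) / (x - α)^m`. -/
def singlePoleFractions (K : Type*) {L : Type*} [Field K] [Field L] [Algebra K L] (x : L) : Set L :=
  {r | ∃ (Q : K[X]) (α : K) (m : ℕ), r = aeval x Q * ((x - algebraMap K L α) ^ m)⁻¹}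

lemma Transcendental.sub_algebraMap_ne_zero (hx : Transcendental K x) (α : K) :
    x - algebraMap K L α ≠ 0 := by
  intro h
  rw [sub_eq_zero] at h
  exact hx (h ▸ isAlgebraic_algebraMap α)

/-- Separates the leading polar term at `α` of a fraction with numerator `Q` from a part of lower
pole order. -/
lemma exists_eq_C_add_X_sub_C_mul (Q : K[X]) (α : K) :
    ∃ R : K[X], Q = C (Q.eval α) + (X - C α) * R :=
  ⟨Q /ₘ (X - C α), by rw [← modByMonic_X_sub_C_eq_C_eval, modByMonic_add_div]⟩

lemma aeval_eq_add_sub_mul (x : L) {Q R : K[X]} {α : K}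
    (h : Q = C (Q.eval α) + (X - C α) * R) :
    aeval x Q = algebraMap K L (Q.eval α) + (x - algebraMap K L α) * aeval x R := by
  conv_lhs => rw [h]
  simp

/-- For `α ≠ β`, the identity `1/((x-α)(x-β)) = (α-β)⁻¹ (1/(x-α) - 1/(x-β))` lowers the exponent of
`x - α` in the product by one. -/
lemma inv_sub_mul_mem_span (hx : Transcendental K x) (β : K) {r : L}
    (hr : r ∈ singlePoleFractions K x) :
    (x - algebraMap K L β)⁻¹ * r ∈ Submodule.span K (singlePoleFractions K x) := by
  obtain ⟨Q, α, m, rfl⟩ := hr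
  have hβ := hx.sub_algebraMap_ne_zero β
  have hα := hx.sub_algebraMap_ne_zero α
  by_cases hαβ : α = β
  · subst hαβ
    refine Submodule.subset_span ⟨Q, α, m + 1, ?_⟩
    rw [pow_succ, mul_inv]
    ring
  induction m generalizing Q with
  | zero => exact Submodule.subset_span ⟨Q, β, 1, by simp [mul_comm]⟩
  | succ m ih =>
    have hne : algebraMap K L α - algebraMap K L β ≠ 0 := by
      rw [← map_sub]
      simpa [sub_eq_zero] using hαβ
    have key : (x - algebraMap K L β)⁻¹ * (aeval x Q * ((x - algebraMap K L α) ^ (m + 1))⁻¹) =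
        (α - β)⁻¹ • (aeval x Q * ((x - algebraMap K L α) ^ (m + 1))⁻¹ -
          (x - algebraMap K L β)⁻¹ * (aeval x Q * ((x - algebraMap K L α) ^ m)⁻¹)) := by
      rw [Algebra.smul_def, map_inv₀, map_sub]
      field_simp
      ring
    rw [key]
    exact Submodule.smul_mem _ _ (sub_mem (Submodule.subset_span ⟨Q, α, m + 1, rfl⟩) (ih Q))

lemma inv_sub_mul_mem_span_of_mem_span (hx : Transcendental K x) (β : K) {r : L}
    (hr : r ∈ Submodule.span K (singlePoleFractions K x)) :
    (x - algebraMap K L β)⁻¹ * r ∈ Submodule.span K (singlePoleFractions K x) := by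
  induction hr using Submodule.span_induction with
  | mem r hr => exact inv_sub_mul_mem_span hx β hr
  | zero => simp
  | add a b _ _ ha hb => rw [mul_add]; exact add_mem ha hb
  | smul c a _ ha => rw [mul_smul_comm]; exact Submodule.smul_mem _ _ ha

/-- Partial fraction decomposition over an algebraically closed field. -/
lemma aeval_mul_inv_aeval_mem_span [IsAlgClosed K] (hx : Transcendental K x) (P Q : K[X]) :
    aeval x P * (aeval x Q)⁻¹ ∈ Submodule.span K (singlePoleFractions K x) := by
  have hprod : ∀ s : Multiset K, aeval x P * (aeval x (s.map fun a => X - C a).prod)⁻¹ ∈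
      Submodule.span K (singlePoleFractions K x) := by
    intro s
    induction s using Multiset.induction_on with
    | empty => exact Submodule.subset_span ⟨P, 0, 0, by simp⟩
    | cons a s ih =>
      have := inv_sub_mul_mem_span_of_mem_span hx a ih
      convert this using 1
      rw [Multiset.map_cons, Multiset.prod_cons, map_mul, mul_inv]
      simp only [map_sub, aeval_X, aeval_C]
      ring
  have hQ := (IsAlgClosed.splits Q).eq_prod_roots
  have : aeval x P * (aeval x Q)⁻¹ =
      Q.leadingCoeff⁻¹ • (aeval x P * (aeval x (Q.roots.map fun a => X - C a).prod)⁻¹) := by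
    conv_lhs => rw [hQ]
    rw [map_mul, mul_inv, Algebra.smul_def, aeval_C, map_inv₀]
    ring
  rw [this]
  exact Submodule.smul_mem _ _ (hprod _)

lemma exists_eq_aeval_mul_inv_aeval {a : L}
    (ha : a ∈ Subfield.closure (Set.range (algebraMap K L) ∪ {x})) :
    ∃ P Q : K[X], a = aeval x P * (aeval x Q)⁻¹ := by
  -- `IntermediateField.adjoin` is defined by this same closure.
  have h : Subfield.closure (Set.range (algebraMap K L) ∪ {x}) =
      (IntermediateField.adjoin K {x}).toSubfield := by
    rfl
  rw [h, IntermediateField.mem_toSubfield, IntermediateField.mem_adjoin_simple_iff] at ha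
  simpa [div_eq_mul_inv] using ha

end PartialFractions

/-! ### The field of rational functions on a hyperelliptic curve -/

/-- Since `y² ∈ S`, the set `S + S y` is closed under products, and under inverses by multiplying
with the conjugate `r - s y`. -/
lemma exists_add_mul_of_mem_closure {L : Type*} [Field L] {y : L} {S : Subfield L} (hy : y ^ 2 ∈ S)
    {T : Set L} (hT : ∀ t ∈ T, t ∈ S ∨ t = y) {a : L} (ha : a ∈ Subfield.closure T) :
    ∃ r ∈ S, ∃ s ∈ S, a = r + s * y := by
  induction ha using Subfield.closure_induction with
  | mem a ha =>
    rcases hT a ha with h | rfl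
    · exact ⟨a, h, 0, zero_mem S, by simp⟩
    · exact ⟨0, zero_mem S, 1, one_mem S, by simp⟩
  | one => exact ⟨1, one_mem S, 0, zero_mem S, by simp⟩
  | add a b _ _ iha ihb =>
    obtain ⟨r, hr, s, hs, rfl⟩ := iha
    obtain ⟨r', hr', s', hs', rfl⟩ := ihb
    exact ⟨r + r', add_mem hr hr', s + s', add_mem hs hs', by ring⟩
  | neg a _ iha =>
    obtain ⟨r, hr, s, hs, rfl⟩ := iha
    exact ⟨-r, neg_mem hr, -s, neg_mem hs, by ring⟩
  | mul a b _ _ iha ihb =>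
    obtain ⟨r, hr, s, hs, rfl⟩ := iha
    obtain ⟨r', hr', s', hs', rfl⟩ := ihb
    exact ⟨r * r' + s * s' * y ^ 2, add_mem (mul_mem hr hr') (mul_mem (mul_mem hs hs') hy),
      r * s' + s * r', add_mem (mul_mem hr hs') (mul_mem hs hr'), by ring⟩
  | inv a _ iha =>
    obtain ⟨r, hr, s, hs, rfl⟩ := iha
    -- The conjugate may vanish, as `y ∈ S` is not excluded; then the element is `2r`.
    by_cases h : r - s * y = 0
    · refine ⟨(2 * r)⁻¹, inv_mem (mul_mem (ofNat_mem S 2) hr), 0, zero_mem S, ?_⟩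
      rw [← sub_eq_zero.mp h]
      ring
    by_cases h' : r + s * y = 0
    · exact ⟨0, zero_mem S, 0, zero_mem S, by simp [h']⟩
    have hN : r ^ 2 - s ^ 2 * y ^ 2 ∈ S := sub_mem (pow_mem hr 2) (mul_mem (pow_mem hs 2) hy)
    refine ⟨r * (r ^ 2 - s ^ 2 * y ^ 2)⁻¹, mul_mem hr (inv_mem hN),
      -s * (r ^ 2 - s ^ 2 * y ^ 2)⁻¹, mul_mem (neg_mem hs) (inv_mem hN), ?_⟩
    have hN' : r ^ 2 - s ^ 2 * y ^ 2 = (r + s * y) * (r - s * y) := by ring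
    rw [hN']
    field_simp
    ring

/-! ### Reduction of differential forms -/

section Reduction

open Polynomial

variable {K L V : Type*} [Field K] [Field L] [Algebra K L] [AddCommGroup V] [Module L V]
  [Module K V] {x y : L}

/-- This polynomial is the coefficient of `dx/(2y)` in `d(x^j y)`. -/
lemma natDegree_reduction_le {f : K[X]} (hf : 1 ≤ f.natDegree) (j : ℕ) :
    (X ^ j * derivative f + 2 * derivative (X ^ j) * f).natDegree ≤ j + (f.natDegree - 1) := by
  refine natDegree_add_le_of_degree_le ?_ ?_
  · exact natDegree_mul_le_of_le (natDegree_X_pow_le j) (natDegree_derivative_le f)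
  cases j with
  | zero => simp
  | succ j =>
    have h := natDegree_mul_le_of_le (p := 2 * derivative (X ^ (j + 1))) (q := f) (m := j)
      (n := f.natDegree) ?_ le_rfl
    · omega
    · have h2 : (2 * derivative (X ^ (j + 1)) : K[X]) = C (2 * ((j : K) + 1)) * X ^ j := by
        rw [derivative_X_pow, C_mul, map_ofNat]
        push_cast
        simp only [map_add, map_natCast, map_one]
        ring
      rw [h2]
      exact natDegree_C_mul_X_pow_le _ _

/-- The two products contribute `deg f` and `2j` times the leading coefficient of `f`, and `deg f +
2j` is nonzero in characteristic zero. -/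
lemma coeff_reduction_ne_zero [CharZero K] {f : K[X]} (hf : 1 ≤ f.natDegree) (j : ℕ) :
    (X ^ j * derivative f + 2 * derivative (X ^ j) * f).coeff (j + (f.natDegree - 1)) ≠ 0 := by
  obtain ⟨e, he⟩ := Nat.exists_eq_add_of_le' hf
  have hlc : f.coeff (e + 1) ≠ 0 := by
    rw [← he, coeff_natDegree, leadingCoeff_ne_zero]
    rintro rfl
    simp at hf
  have : (X ^ j * derivative f + 2 * derivative (X ^ j) * f).coeff (j + (f.natDegree - 1)) =
      ((e + 1 + 2 * j : ℕ) : K) * f.coeff (e + 1) := by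
    rw [he, Nat.add_sub_cancel, coeff_add, add_comm j e, coeff_X_pow_mul, coeff_derivative]
    cases j with
    | zero => simp [mul_comm]
    | succ j =>
      have h2 : 2 * derivative (X ^ (j + 1)) * f = C (2 * ((j : K) + 1)) * (X ^ j * f) := by
        rw [derivative_X_pow, C_mul, map_ofNat]
        push_cast
        simp only [map_add, map_natCast, map_one]
        ring
      rw [h2, coeff_C_mul, show e + (j + 1) = e + 1 + j by ring, coeff_X_pow_mul]
      push_cast
      ring
  rw [this]
  exact mul_ne_zero (by exact_mod_cast (by omega : e + 1 + 2 * j ≠ 0)) hlc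

/-! ### Derivatives of functions on the curve -/

section Derivation

variable (d : Derivation K L V)

lemma Derivation.apply_inv_sub_pow (x : L) (α : K) (m : ℕ) (hx : x - algebraMap K L α ≠ 0) :
    d ((x - algebraMap K L α) ^ m)⁻¹ =
      (-(m : L) * ((x - algebraMap K L α) ^ (m + 1))⁻¹) • d x := by
  rw [Derivation.leibniz_inv, Derivation.leibniz_pow, map_sub, Derivation.map_algebraMap, sub_zero,
    ← Nat.cast_smul_eq_nsmul L, smul_smul, smul_smul]
  congr 1
  cases m with
  | zero => simp
  | succ m =>
    rw [Nat.add_sub_cancel]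
    field_simp
    ring

/-- If `y² = f(x)`, then `dy` is the multiple of `dx / (2y)` by the derivative of `f` at `x`. -/
lemma Derivation.apply_eq_of_sq_eq [CharZero L] {f : K[X]} (hy : y ≠ 0) (hxy : y ^ 2 = aeval x f) :
    d y = aeval x (derivative f) • ((2 * y)⁻¹ • d x) := by
  have h := congrArg d hxy
  rw [Derivation.map_aeval, Derivation.leibniz_pow, ← Nat.cast_smul_eq_nsmul L, smul_smul] at h
  rw [smul_comm, ← h, smul_smul]
  simp only [Nat.cast_ofNat, Nat.add_one_sub_one, pow_one]
  rw [inv_mul_cancel₀ (mul_ne_zero two_ne_zero hy), one_smul]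

/-- The source of every relation between the forms `s dx/(2y)`: here `y dr = 2 y² dr/(2y)`, and `y²`
is replaced by `f(x)`. -/
lemma Derivation.apply_mul_of_sq_eq [CharZero L] {f : K[X]} (hy : y ≠ 0)
    (hxy : y ^ 2 = aeval x f) {r s : L} (hr : d r = s • d x) :
    d (r * y) = (r * aeval x (derivative f) + 2 * s * aeval x f) • ((2 * y)⁻¹ • d x) := by
  rw [Derivation.leibniz, d.apply_eq_of_sq_eq hy hxy, hr, ← hxy]
  simp only [smul_smul, ← add_smul]
  congr 1
  field_simp

/-- The sum, product and inverse rules carry the property from generators to the field; with `η =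
dx` this makes every `db` a multiple of `dx`. -/
lemma Derivation.exists_smul_of_mem_closure {S : Subfield L} {η : V} {T : Set L}
    (hTS : Subfield.closure T ≤ S) (hT : ∀ t ∈ T, ∃ s ∈ S, d t = s • η) {b : L}
    (hb : b ∈ Subfield.closure T) : ∃ s ∈ S, d b = s • η := by
  induction hb using Subfield.closure_induction with
  | mem b hb => exact hT b hb
  | one => exact ⟨0, zero_mem S, by simp⟩
  | add a b _ _ iha ihb =>
    obtain ⟨s, hs, h⟩ := iha
    obtain ⟨t, ht, h'⟩ := ihb
    exact ⟨s + t, add_mem hs ht, by rw [map_add, h, h', add_smul]⟩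
  | neg a _ iha =>
    obtain ⟨s, hs, h⟩ := iha
    exact ⟨-s, neg_mem hs, by rw [map_neg, h, neg_smul]⟩
  | mul a b ha hb iha ihb =>
    obtain ⟨s, hs, h⟩ := iha
    obtain ⟨t, ht, h'⟩ := ihb
    exact ⟨a * t + b * s, add_mem (mul_mem (hTS ha) ht) (mul_mem (hTS hb) hs), by
      rw [Derivation.leibniz, h, h', smul_smul, smul_smul, add_smul]⟩
  | inv a ha iha =>
    obtain ⟨s, hs, h⟩ := iha
    exact ⟨-a⁻¹ ^ 2 * s, mul_mem (neg_mem (pow_mem (inv_mem (hTS ha)) 2)) hs, by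
      rw [Derivation.leibniz_inv, h, smul_smul]⟩

end Derivation

/-! ### Lowering degrees and pole orders -/

variable [IsScalarTower K L V]

lemma smul_mem_of_mem_span {W : Submodule K V} {η : V} {S : Set L}
    (h : ∀ r ∈ S, r • η ∈ W) {a : L} (ha : a ∈ Submodule.span K S) : a • η ∈ W := by
  induction ha using Submodule.span_induction with
  | mem r hr => exact h r hr
  | zero => simp
  | add a b _ _ ha hb => rw [add_smul]; exact add_mem ha hb
  | smul c a _ ha => rw [smul_assoc]; exact Submodule.smul_mem _ _ ha

/-- To see that all `Q(x) / (x - α)^m • η` lie in `W` it is enough to treat the polynomials and, for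
every `m`, the fraction `1 / (x - α)^(m+1)`, assuming the claim for smaller exponents. -/
lemma aeval_mul_inv_pow_smul_mem (hx : Transcendental K x) {W : Submodule K V} {η : V} {α : K}
    (h0 : ∀ Q : K[X], aeval x Q • η ∈ W)
    (hstep : ∀ m : ℕ, (∀ Q : K[X], (aeval x Q * ((x - algebraMap K L α) ^ m)⁻¹) • η ∈ W) →
      ((x - algebraMap K L α) ^ (m + 1))⁻¹ • η ∈ W) (m : ℕ) (Q : K[X]) :
    (aeval x Q * ((x - algebraMap K L α) ^ m)⁻¹) • η ∈ W := by
  have hα := hx.sub_algebraMap_ne_zero α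
  induction m generalizing Q with
  | zero => simpa using h0 Q
  | succ m ih =>
    obtain ⟨R, hR⟩ := exists_eq_C_add_X_sub_C_mul Q α
    have : aeval x Q * ((x - algebraMap K L α) ^ (m + 1))⁻¹ =
        Q.eval α • ((x - algebraMap K L α) ^ (m + 1))⁻¹ +
          aeval x R * ((x - algebraMap K L α) ^ m)⁻¹ := by
      rw [aeval_eq_add_sub_mul x hR, Algebra.smul_def]
      field_simp
      ring
    rw [this, add_smul, smul_assoc]
    exact add_mem (Submodule.smul_mem _ _ (hstep m ih)) (ih R)

variable [CharZero K] (d : Derivation K L V)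

/-- The forms `r(x) dx` with a rational function `r` are sums of exact and logarithmic forms. -/
lemma singlePoleFraction_smul_mem (hx : Transcendental K x) {W : Submodule K V}
    (hpoly : ∀ Q : K[X], d (aeval x Q) ∈ W)
    (hexact : ∀ (α : K) (m : ℕ), d ((x - algebraMap K L α) ^ m)⁻¹ ∈ W)
    (hlog : ∀ α : K, (x - algebraMap K L α)⁻¹ • d x ∈ W)
    {r : L} (hr : r ∈ singlePoleFractions K x) : r • d x ∈ W := by
  have : CharZero L := charZero_of_injective_algebraMap (algebraMap K L).injective
  obtain ⟨Q, α, m, rfl⟩ := hr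
  refine aeval_mul_inv_pow_smul_mem hx (fun Q => ?_) (fun m _ => ?_) m Q
  · induction Q using Polynomial.induction_on' with
    | add P Q hP hQ => rw [map_add, add_smul]; exact add_mem hP hQ
    | monomial n c =>
      have h := hpoly (monomial (n + 1) (c / (n + 1)))
      rw [Derivation.map_aeval, derivative_monomial] at h
      have hn : (n + 1 : K) ≠ 0 := by exact_mod_cast n.succ_ne_zero
      rwa [Nat.add_sub_cancel, Nat.cast_add_one, div_mul_cancel₀ c hn] at h
  -- The pole order is `m + 1`: `m = 0` is the logarithmic case, otherwise divide the derivative of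
  -- `(x - α)^(-m)` by `-m`.
  · rcases Nat.eq_zero_or_pos m with rfl | hm
    · simpa using hlog α
    have h := hexact α m
    rw [d.apply_inv_sub_pow x α m (hx.sub_algebraMap_ne_zero α)] at h
    have hm' : (m : K) ≠ 0 := by exact_mod_cast hm.ne'
    have h2 := W.smul_mem (-(m : K)⁻¹) h
    rw [← smul_assoc, Algebra.smul_def] at h2
    convert h2 using 2
    have : (m : L) ≠ 0 := by exact_mod_cast hm.ne'
    simp only [map_neg, map_inv₀, map_natCast]
    field_simp

/-- The forms `Q(x) dx / (2y)` reduce to those with `deg Q ≤ deg f - 2`. -/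
lemma aeval_smul_mem [CharZero L] {f : K[X]} (hf : 1 ≤ f.natDegree) (hy : y ≠ 0)
    (hxy : y ^ 2 = aeval x f) {W : Submodule K V}
    (hexact : ∀ j : ℕ, d (x ^ j * y) ∈ W)
    (hω : ∀ i < f.natDegree - 1, x ^ i • ((2 * y)⁻¹ • d x) ∈ W) (Q : K[X]) :
    aeval x Q • ((2 * y)⁻¹ • d x) ∈ W := by
  have hmon : ∀ n : ℕ, x ^ n • ((2 * y)⁻¹ • d x) ∈ W := by
    intro n
    induction n using Nat.strong_induction_on with
    | _ n ih =>
    by_cases hn : n < f.natDegree - 1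
    · exact hω n hn
    -- With this `j`, the monomial `x^n` is the top term of the coefficient of `d(x^j y)`; all lower
    -- terms are in `W` by induction.
    obtain ⟨j, rfl⟩ := Nat.exists_eq_add_of_le' (not_lt.mp hn)
    have hA := hexact j
    have hxj : d (x ^ j) = aeval x (derivative (X ^ j : K[X])) • d x := by
      rw [← Derivation.map_aeval, aeval_X_pow]
    rw [d.apply_mul_of_sq_eq hy hxy hxj] at hA
    have heq : x ^ j * aeval x (derivative f) +
        2 * aeval x (derivative (X ^ j : K[X])) * aeval x f =
        aeval x (X ^ j * derivative f + 2 * derivative (X ^ j) * f) := by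
      simp only [map_add, map_mul, map_pow, aeval_X, map_ofNat]
    rw [heq, as_sum_range' _ _ (Nat.lt_succ_of_le (natDegree_reduction_le hf j)), map_sum,
      Finset.sum_range_succ, add_smul, Finset.sum_smul] at hA
    simp only [aeval_monomial, ← Algebra.smul_def, smul_assoc] at hA
    have hlow := (W.add_mem_iff_right (Submodule.sum_mem _ fun i hi =>
      W.smul_mem _ (ih i (Finset.mem_range.mp hi)))).mp hA
    exact (W.smul_mem_iff (coeff_reduction_ne_zero hf j)).mp hlow
  induction Q using Polynomial.induction_on' with
  | add P Q hP hQ => rw [map_add, add_smul]; exact add_mem hP hQ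
  | monomial n c =>
    rw [aeval_monomial, ← Algebra.smul_def, smul_assoc]
    exact W.smul_mem c (hmon n)

/-- The forms `Q(x) / (x - α)^m dx / (2y)` reduce to polynomial ones and to simple poles outside the
branch points. -/
lemma singlePoleFraction_smul_mem_of_sq_eq [CharZero L] {f : K[X]} (hf : Squarefree f)
    (hx : Transcendental K x) (hy : y ≠ 0)
    (hxy : y ^ 2 = aeval x f) {W : Submodule K V}
    (hpoly : ∀ Q : K[X], aeval x Q • ((2 * y)⁻¹ • d x) ∈ W)
    (hexact : ∀ (α : K) (m : ℕ), d (((x - algebraMap K L α) ^ m)⁻¹ * y) ∈ W)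
    (hν : ∀ α : K, f.eval α ≠ 0 → (x - algebraMap K L α)⁻¹ • ((2 * y)⁻¹ • d x) ∈ W)
    {r : L} (hr : r ∈ singlePoleFractions K x) : r • ((2 * y)⁻¹ • d x) ∈ W := by
  obtain ⟨Q, α, m, rfl⟩ := hr
  have hα := hx.sub_algebraMap_ne_zero α
  refine aeval_mul_inv_pow_smul_mem hx hpoly (fun m ih => ?_) m Q
  obtain ⟨g, hg⟩ := exists_eq_C_add_X_sub_C_mul f α
  have hfx := aeval_eq_add_sub_mul x hg
  /- It is enough to have an element of `W` with the right polar part. -/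
  have key : ∀ (R : K[X]), R.eval α ≠ 0 →
      (aeval x R * ((x - algebraMap K L α) ^ (m + 1))⁻¹) • ((2 * y)⁻¹ • d x) ∈ W →
      ((x - algebraMap K L α) ^ (m + 1))⁻¹ • ((2 * y)⁻¹ • d x) ∈ W := by
    intro R hR hmem
    obtain ⟨R', hR'⟩ := exists_eq_C_add_X_sub_C_mul R α
    -- Subtracting `R'(x)/(x - α)^m` leaves only the constant `R(α)` in the numerator.
    have h := W.smul_mem (R.eval α)⁻¹ (sub_mem hmem (ih R'))
    rw [← sub_smul, ← smul_assoc, aeval_eq_add_sub_mul x hR', Algebra.smul_def] at h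
    convert h using 2
    have : algebraMap K L (R.eval α) ≠ 0 := by simpa using hR
    rw [map_inv₀]
    field_simp
    ring
  by_cases hfα : f.eval α = 0
  -- A branch point: `f = (x - α) g`, and `g(α) = 0` would make `α` a double root.
  · have hgα : g.eval α ≠ 0 := by
      intro h0
      obtain ⟨g', hg'⟩ := exists_eq_C_add_X_sub_C_mul g α
      rw [h0, map_zero, zero_add] at hg'
      rw [hfα, map_zero, zero_add, hg', ← mul_assoc] at hg
      exact not_isUnit_X_sub_C α (hf _ ⟨g', hg⟩)
    rw [hfα, map_zero, zero_add] at hfx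
    -- The numerator of `d((x-α)^(-(m+1)) y)` after cancelling `x - α`. At `α` it equals `-(2m+1)
    -- g(α)`, nonzero also for `m = 0`, so simple poles go too.
    refine key (derivative f - 2 * C ((m + 1 : ℕ) : K) * g) ?_ ?_
    · have hd : (derivative f).eval α = g.eval α := by
        rw [hg, hfα]
        simp
      have h2 : ((2 * m + 1 : ℕ) : K) ≠ 0 := by exact_mod_cast (2 * m).succ_ne_zero
      have : (derivative f - 2 * C ((m + 1 : ℕ) : K) * g).eval α =
          -(((2 * m + 1 : ℕ) : K) * g.eval α) := by
        simp only [eval_sub, eval_mul, eval_ofNat, eval_C, hd]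
        push_cast
        ring
      rw [this]
      exact neg_ne_zero.mpr (mul_ne_zero h2 hgα)
    · have h := hexact α (m + 1)
      rw [d.apply_mul_of_sq_eq hy hxy (d.apply_inv_sub_pow x α (m + 1) hα), hfx] at h
      convert h using 2
      simp only [map_sub, map_mul, map_ofNat, map_natCast]
      field_simp
      ring
  · rcases Nat.eq_zero_or_pos m with rfl | hm
    · simpa using hν α hfα
    have hm' : (m : K) ≠ 0 := by exact_mod_cast hm.ne'
    -- The leading polar part of `-d((x-α)^(-m) y)`; the remaining term `f'/(x-α)^m` is in `W` by
    -- induction.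
    refine key (2 * C (m : K) * f) (by simp [hm', hfα]) ?_
    have h := hexact α m
    rw [d.apply_mul_of_sq_eq hy hxy (d.apply_inv_sub_pow x α m hα)] at h
    have h' := sub_mem (ih (derivative f)) h
    rw [← sub_smul] at h'
    convert h' using 2
    simp only [map_mul, map_ofNat, map_natCast]
    ring

/-- On the curve `y² = f(x)` over an algebraically closed field of characteristic zero, every rational
form `a db` is a sum of exact forms, logarithmic forms, the forms `x^i dx / (2y)` with `i ≤ deg f - 2`
and the forms `dx / (2y(x - α))` with `f(α) ≠ 0`. -/
theorem smul_apply_mem_of_sq_eq [IsAlgClosed K] [CharZero L] {f : K[X]} (hf : Squarefree f)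
    (hdeg : 1 ≤ f.natDegree) (hx : Transcendental K x) (hxy : y ^ 2 = aeval x f) {W : Submodule K V}
    (hexact : ∀ F ∈ Subfield.closure (Set.range (algebraMap K L) ∪ {x, y}), d F ∈ W)
    (hlog : ∀ h ∈ Subfield.closure (Set.range (algebraMap K L) ∪ {x, y}), h ≠ 0 →
      h⁻¹ • d h ∈ W)
    (hω : ∀ i < f.natDegree - 1, x ^ i • ((2 * y)⁻¹ • d x) ∈ W)
    (hν : ∀ α : K, f.eval α ≠ 0 → (x - algebraMap K L α)⁻¹ • ((2 * y)⁻¹ • d x) ∈ W)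
    {a b : L} (ha : a ∈ Subfield.closure (Set.range (algebraMap K L) ∪ {x, y}))
    (hb : b ∈ Subfield.closure (Set.range (algebraMap K L) ∪ {x, y})) : a • d b ∈ W := by
  set S := Subfield.closure (Set.range (algebraMap K L) ∪ {x, y}) with hS
  set S₀ := Subfield.closure (Set.range (algebraMap K L) ∪ {x}) with hS₀
  have hf0 : f ≠ 0 := hf.ne_zero
  have hy : y ≠ 0 := by
    rintro rfl
    exact hx ⟨f, hf0, by rw [← hxy]; simp⟩
  have hC : ∀ c : K, algebraMap K L c ∈ S := fun c => Subfield.subset_closure (Or.inl ⟨c, rfl⟩)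
  have hxS : x ∈ S := Subfield.subset_closure (Or.inr (Or.inl rfl))
  have hyS : y ∈ S := Subfield.subset_closure (Or.inr (Or.inr rfl))
  have haeval : ∀ {S' : Subfield L}, (∀ c : K, algebraMap K L c ∈ S') → x ∈ S' →
      ∀ Q : K[X], aeval x Q ∈ S' := by
    intro S' h1 h2 Q
    rw [aeval_eq_sum_range]
    refine sum_mem fun i _ => ?_
    rw [Algebra.smul_def]
    exact mul_mem (h1 _) (pow_mem h2 _)
  have hfS₀ : aeval x f ∈ S₀ := haeval (fun c => Subfield.subset_closure (Or.inl ⟨c, rfl⟩))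
    (Subfield.subset_closure (Or.inr rfl)) f
  have hpow : ∀ (α : K) (m : ℕ), ((x - algebraMap K L α) ^ m)⁻¹ ∈ S := fun α m =>
    inv_mem (pow_mem (sub_mem hxS (hC α)) m)
  have hspan : ∀ r ∈ S₀, r ∈ Submodule.span K (singlePoleFractions K x) := by
    intro r hr
    obtain ⟨P, Q, rfl⟩ := exists_eq_aeval_mul_inv_aeval hr
    exact aeval_mul_inv_aeval_mem_span hx P Q
  have hdx : ∀ r ∈ S₀, r • d x ∈ W := fun r hr =>
    smul_mem_of_mem_span (fun r hr => singlePoleFraction_smul_mem d hx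
      (fun Q => hexact _ (haeval hC hxS Q)) (fun α m => hexact _ (hpow α m))
      (fun α => by
        have := hlog _ (sub_mem hxS (hC α)) (hx.sub_algebraMap_ne_zero α)
        simpa using this) hr) (hspan r hr)
  have hdxy : ∀ r ∈ S₀, r • ((2 * y)⁻¹ • d x) ∈ W := fun r hr =>
    smul_mem_of_mem_span (fun r hr => singlePoleFraction_smul_mem_of_sq_eq d hf hx hy hxy
      (aeval_smul_mem d hdeg hy hxy (fun j => hexact _ (mul_mem (pow_mem hxS j) hyS)) hω)
      (fun α m => hexact _ (mul_mem (hpow α m) hyS)) hν hr) (hspan r hr)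
  have hSdx : ∀ r ∈ S, r • d x ∈ W := by
    intro r hr
    obtain ⟨r, hr', s, hs, rfl⟩ := exists_add_mul_of_mem_closure (S := S₀) (y := y) (hxy ▸ hfS₀) (by
      rintro t (ht | rfl | rfl)
      · exact Or.inl (Subfield.subset_closure (Or.inl ht))
      · exact Or.inl (Subfield.subset_closure (Or.inr rfl))
      · exact Or.inr rfl) hr
    rw [add_smul]
    refine add_mem (hdx r hr') ?_
    -- The identity `s y dx = 2 s y² dx/(2y)`.
    convert hdxy (2 * s * aeval x f)
      (mul_mem (mul_mem (ofNat_mem S₀ 2) hs) hfS₀) using 1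
    rw [smul_smul, ← hxy]
    congr 1
    field_simp
  obtain ⟨s, hs, h⟩ := d.exists_smul_of_mem_closure (S := S) (η := d x) le_rfl (by
    rintro t (⟨c, rfl⟩ | rfl | rfl)
    · exact ⟨0, zero_mem S, by simp⟩
    · exact ⟨1, one_mem S, by simp⟩
    · refine ⟨aeval x (derivative f) * (2 * t)⁻¹, mul_mem (haeval hC hxS _)
        (inv_mem (mul_mem (ofNat_mem S 2) hyS)), ?_⟩
      rw [d.apply_eq_of_sq_eq hy hxy, smul_smul]) hb
  rw [h, smul_smul]
  exact hSdx _ (mul_mem ha hs)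

/-- The decomposition of rational forms on `y² = f(x)`, with explicit data. -/
theorem exists_decomposition_of_sq_eq [IsAlgClosed K] [CharZero L] {f : K[X]} (hf : Squarefree f)
    (hdeg : 1 ≤ f.natDegree) (hx : Transcendental K x) (hxy : y ^ 2 = aeval x f) {S : Subfield L}
    (hS : S = Subfield.closure (Set.range (algebraMap K L) ∪ {x, y})) {ω : V}
    (hω : ω ∈ AddSubgroup.closure {η | ∃ a ∈ S, ∃ b ∈ S, η = a • d b}) :
    ∃ (F : L) (n m : ℕ) (c : Fin n → K) (h : Fin n → L) (e : Fin (f.natDegree - 1) → K)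
      (b β : Fin m → K), F ∈ S ∧ (∀ i, h i ∈ S ∧ h i ≠ 0) ∧ (∀ j, f.eval (β j) ≠ 0) ∧
      ω = d F + ∑ i, c i • ((h i)⁻¹ • d (h i))
        + ∑ i, e i • (x ^ (i : ℕ) • ((2 * y)⁻¹ • d x))
        + ∑ j, b j • ((x - algebraMap K L (β j))⁻¹ • ((2 * y)⁻¹ • d x)) := by
  -- As `S` is a `K`-subspace, the exact forms `d(S)` form one as well, so a single `F` suffices.
  let M : Submodule K L :=
    { carrier := S
      add_mem' := add_mem
      zero_mem' := zero_mem S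
      smul_mem' := fun c a ha => by
        rw [Algebra.smul_def]
        exact mul_mem (hS ▸ Subfield.subset_closure (Or.inl ⟨c, rfl⟩)) ha }
  let A := M.map d.toLinearMap
  let B := Submodule.span K {η | ∃ h ∈ S, h ≠ 0 ∧ η = h⁻¹ • d h}
  let C := Submodule.span K
    (Set.range fun i : Fin (f.natDegree - 1) => x ^ (i : ℕ) • ((2 * y)⁻¹ • d x))
  let E := Submodule.span K
    {η | ∃ α : K, f.eval α ≠ 0 ∧ η = (x - algebraMap K L α)⁻¹ • ((2 * y)⁻¹ • d x)}
  have hmem : ω ∈ A ⊔ B ⊔ C ⊔ E := by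
    have hle : AddSubgroup.closure {η | ∃ a ∈ S, ∃ b ∈ S, η = a • d b} ≤
        (A ⊔ B ⊔ C ⊔ E).toAddSubgroup := by
      rw [AddSubgroup.closure_le]
      rintro _ ⟨a, ha, b, hb, rfl⟩
      rw [hS] at ha hb
      change a • d b ∈ A ⊔ B ⊔ C ⊔ E
      refine smul_apply_mem_of_sq_eq d hf hdeg hx hxy ?_ ?_ ?_ ?_ ha hb
      · intro F hF
        have : d F ∈ A := ⟨F, (hS ▸ hF : F ∈ S), rfl⟩
        exact Submodule.mem_sup_left (Submodule.mem_sup_left (Submodule.mem_sup_left this))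
      · intro h hh h0
        have : h⁻¹ • d h ∈ B := Submodule.subset_span ⟨h, hS ▸ hh, h0, rfl⟩
        exact Submodule.mem_sup_left (Submodule.mem_sup_left (Submodule.mem_sup_right this))
      · intro i hi
        have : x ^ i • ((2 * y)⁻¹ • d x) ∈ C := Submodule.subset_span ⟨⟨i, hi⟩, rfl⟩
        exact Submodule.mem_sup_left (Submodule.mem_sup_right this)
      · intro α hα
        have : (x - algebraMap K L α)⁻¹ • ((2 * y)⁻¹ • d x) ∈ E :=
          Submodule.subset_span ⟨α, hα, rfl⟩
        exact Submodule.mem_sup_right this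
    exact hle hω
  obtain ⟨_, hABC, _, hE, rfl⟩ := Submodule.mem_sup.mp hmem
  obtain ⟨_, hAB, _, hC, rfl⟩ := Submodule.mem_sup.mp hABC
  obtain ⟨_, ⟨F, hF, rfl⟩, _, hB, rfl⟩ := Submodule.mem_sup.mp hAB
  obtain ⟨n, c, g, rfl⟩ := Submodule.mem_span_set'.mp hB
  obtain ⟨e, rfl⟩ := (Submodule.mem_span_range_iff_exists_fun K).mp hC
  obtain ⟨m, b, q, rfl⟩ := Submodule.mem_span_set'.mp hE
  choose h hh h0 heq using fun i => (g i).2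
  choose β hβ hq using fun j => (q j).2
  refine ⟨F, n, m, c, h, e, b, β, hF, fun i => ⟨hh i, h0 i⟩, hβ, ?_⟩
  simp only [heq, hq]
  rfl

end Reduction

/-! ### Regular forms and their integrals -/

section Integral

variable {k F : Type*} [NormedField k] [Field F] [Algebra k F] {U : Opens (BerkPoint k F)}

lemma IsRegularOn.add {η₁ η₂ : Ω[F⁄k]} (h₁ : IsRegularOn U η₁) (h₂ : IsRegularOn U η₂) :
    IsRegularOn U (η₁ + η₂) := fun v hv => add_mem (h₁ v hv) (h₂ v hv)

lemma IsRegularOn.smul {η : Ω[F⁄k]} (c : k) (h : IsRegularOn U η) : IsRegularOn U (c • η) :=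
  fun v hv => Submodule.smul_mem _ c (h v hv)

lemma isRegularOn_zero : IsRegularOn U (0 : Ω[F⁄k]) := fun _ _ => zero_mem _

lemma HasNoPoleOn.isRegularOn_D {a : F} (h : HasNoPoleOn U a) :
    IsRegularOn U (KaehlerDifferential.D k F a) := fun v hv =>
  Submodule.subset_span ⟨1, a, by simpa using (v.val_algebraMap 1).trans_lt enorm_lt_top, h v hv,
    (one_smul F _).symm⟩

lemma IsUnitOn.isRegularOn_inv_smul_D {a : F} (ha : a ≠ 0) (h : IsUnitOn U a) :
    IsRegularOn U (a⁻¹ • KaehlerDifferential.D k F a) := fun v hv =>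
  Submodule.subset_span ⟨a⁻¹, a, by
    rw [v.val_inv a ha, ENNReal.inv_lt_top]
    exact pos_iff_ne_zero.mpr (h v hv).1, (h v hv).2, rfl⟩

lemma isRegularOn_sum {ι : Type*} [DecidableEq ι] (s : Finset ι) (c : ι → k) (η : ι → Ω[F⁄k])
    (h : ∀ i, c i ≠ 0 → IsRegularOn U (η i)) : IsRegularOn U (∑ i ∈ s, c i • η i) := by
  induction s using Finset.induction_on with
  | empty => simpa using isRegularOn_zero
  | insert a s ha ih =>
    rw [Finset.sum_insert ha]
    refine IsRegularOn.add ?_ ih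
    by_cases hc : c a = 0
    · simpa [hc] using isRegularOn_zero
    · exact (h a hc).smul _

end Integral

/-! ### Term-by-term integration of meromorphic forms -/

namespace BerkovichColemanIntegration

variable {p : ℕ} [Fact p.Prime] {ℓ : LogBranch p} (I : BerkovichColemanIntegration.{u} p ℓ)
  {F : Type u} [Field F] [Algebra ℂ_[p] F] {U : Opens (BerkPoint ℂ_[p] F)} {x y : U}

lemma meromorphicIntegral_linear (hF : IsCurveFunctionField ℂ_[p] F) (γ : Path x y)
    (hx : x.1.IsRational) (hy : y.1.IsRational)
    {η₁ η₂ : Ω[F⁄ℂ_[p]]} (h₁ : IsRegularOn U η₁)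
    (h₂ : IsRegularOn U η₂) (c₁ c₂ : ℂ_[p]) :
    I.meromorphicIntegral γ (c₁ • η₁ + c₂ • η₂) =
      c₁ * I.meromorphicIntegral γ η₁ + c₂ * I.meromorphicIntegral γ η₂ := by
  have h : IsRegularOn U (c₁ • η₁ + c₂ • η₂) := (h₁.smul c₁).add (h₂.smul c₂)
  rw [meromorphicIntegral, meromorphicIntegral, meromorphicIntegral, dif_pos h, dif_pos h₁,
    dif_pos h₂, ← I.integral_linear γ _ _ c₁ c₂ hF hx hy]
  -- Values of forms are classes in a quotient, so restriction to `U` is linear by definition.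
  congr 1

lemma meromorphicIntegral_add (hF : IsCurveFunctionField ℂ_[p] F) (γ : Path x y)
    (hx : x.1.IsRational) (hy : y.1.IsRational)
    {η₁ η₂ : Ω[F⁄ℂ_[p]]} (h₁ : IsRegularOn U η₁)
    (h₂ : IsRegularOn U η₂) :
    I.meromorphicIntegral γ (η₁ + η₂) =
      I.meromorphicIntegral γ η₁ + I.meromorphicIntegral γ η₂ := by
  simpa using I.meromorphicIntegral_linear hF γ hx hy h₁ h₂ 1 1

lemma meromorphicIntegral_zero (hF : IsCurveFunctionField ℂ_[p] F) (γ : Path x y)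
    (hx : x.1.IsRational) (hy : y.1.IsRational) :
    I.meromorphicIntegral γ (0 : Ω[F⁄ℂ_[p]]) = 0 := by
  simpa using I.meromorphicIntegral_linear hF γ hx hy isRegularOn_zero isRegularOn_zero 0 0

lemma meromorphicIntegral_smul (hF : IsCurveFunctionField ℂ_[p] F) (γ : Path x y)
    (hx : x.1.IsRational) (hy : y.1.IsRational)
    {η : Ω[F⁄ℂ_[p]]} (h : IsRegularOn U η) (c : ℂ_[p]) :
    I.meromorphicIntegral γ (c • η) = c * I.meromorphicIntegral γ η := by
  simpa using I.meromorphicIntegral_linear hF γ hx hy h isRegularOn_zero c 0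

/-- Terms with coefficient zero need not be regular: they vanish on both sides, whatever default
value the integral takes. -/
lemma meromorphicIntegral_sum (hF : IsCurveFunctionField ℂ_[p] F) (γ : Path x y)
    (hx : x.1.IsRational) (hy : y.1.IsRational)
    {ι : Type*} [DecidableEq ι] (s : Finset ι) (c : ι → ℂ_[p])
    (η : ι → Ω[F⁄ℂ_[p]]) (h : ∀ i, c i ≠ 0 → IsRegularOn U (η i)) :
    I.meromorphicIntegral γ (∑ i ∈ s, c i • η i) =
      ∑ i ∈ s, c i * I.meromorphicIntegral γ (η i) := by
  induction s using Finset.induction_on with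
  | empty => simpa using I.meromorphicIntegral_zero hF γ hx hy
  | insert a s ha ih =>
    rw [Finset.sum_insert ha, Finset.sum_insert ha, ← ih]
    by_cases hc : c a = 0
    · simp [hc]
    · rw [I.meromorphicIntegral_add hF γ hx hy ((h a hc).smul _) (isRegularOn_sum s c η h),
        I.meromorphicIntegral_smul hF γ hx hy (h a hc)]

lemma meromorphicIntegral_D (hF : IsCurveFunctionField ℂ_[p] F) (γ : Path x y)
    (hx : x.1.IsRational) (hy : y.1.IsRational)
    {a : F} (ha : HasNoPoleOn U a) :
    I.meromorphicIntegral γ (KaehlerDifferential.D ℂ_[p] F a) = y.1.eval a - x.1.eval a := by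
  rw [meromorphicIntegral, dif_pos ha.isRegularOn_D]
  exact I.integral_exact γ a _ hF hx hy ha

lemma meromorphicIntegral_inv_smul_D (hF : IsCurveFunctionField ℂ_[p] F) (γ : Path x y)
    (hx : x.1.IsRational) (hy : y.1.IsRational)
    {a : F} (ha0 : a ≠ 0) (ha : IsUnitOn U a) :
    I.meromorphicIntegral γ (a⁻¹ • KaehlerDifferential.D ℂ_[p] F a) =
      ℓ.log (y.1.eval a / x.1.eval a) := by
  rw [meromorphicIntegral, dif_pos (ha.isRegularOn_inv_smul_D ha0)]
  exact I.integral_logarithmic γ a _ hF hx hy ha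

end BerkovichColemanIntegration

/-! ### Fields of definition -/

section FieldOfDefinition

open Polynomial

variable {k L : Type*} [Field k] [Field L] [Algebra k L] {x y : L}

/-- `L = k(x)(y)`, and `y` is integral over `k(x)` because `y² = f(x)`. -/
lemma IsHyperellipticFunctionField.isCurveFunctionField {f : k[X]}
    (h : IsHyperellipticFunctionField f x y) : IsCurveFunctionField k L := by
  refine ⟨x, h.transcendental, ?_⟩
  have hx : x ∈ IntermediateField.adjoin k {x} := IntermediateField.mem_adjoin_simple_self k x
  have hint : IsIntegral (IntermediateField.adjoin k {x}) y := by
    refine IsIntegral.of_pow two_pos ?_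
    rw [h.equation]
    have hf := isIntegral_algebraMap (A := L)
      (x := aeval (⟨x, hx⟩ : IntermediateField.adjoin k {x}) f)
    rwa [← aeval_algebraMap_apply] at hf
  have htop : IntermediateField.adjoin (IntermediateField.adjoin k {x}) {y} = ⊤ := by
    apply IntermediateField.restrictScalars_injective k
    rw [IntermediateField.adjoin_adjoin_left, IntermediateField.restrictScalars_top,
      Set.singleton_union, h.generate]
  have := IntermediateField.adjoin.finiteDimensional hint
  rw [htop] at this
  exact IntermediateField.topEquiv.toLinearEquiv.finiteDimensional

lemma meromorphicFormsOver_mono {K₁ K₂ : Subfield k} (h : K₁ ≤ K₂) (x y : L) :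
    meromorphicFormsOver K₁ x y ≤ meromorphicFormsOver K₂ x y := by
  have hle : rationalFunctionsOver K₁ x y ≤ rationalFunctionsOver K₂ x y :=
    Subfield.closure_mono (Set.union_subset_union_left _ (Set.image_mono h))
  refine AddSubgroup.closure_mono ?_
  rintro _ ⟨a, ha, b, hb, rfl⟩
  exact ⟨a, hle ha, b, hle hb, rfl⟩

end FieldOfDefinition

/-- The decomposition of the forms that are defined over an algebraically closed subfield. -/
theorem exists_decomposition_of_mem_meromorphicFormsOver {R k L : Type*} [Field R] [Field k]
    [Algebra R k] [CharZero k] [Field L] [Algebra k L] (K : IntermediateField R k) [IsAlgClosed K]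
    (f : Polynomial K) (hf : Squarefree f) (hd : 1 ≤ f.natDegree) (x y : L)
    (hX : IsHyperellipticFunctionField (f.map (algebraMap K k)) x y)
    (ω : Ω[L⁄k]) (hω : ω ∈ meromorphicFormsOver K.toSubfield x y) :
    ∃ (F : L) (n m : ℕ) (c : Fin n → K) (h : Fin n → L) (e : Fin (f.natDegree - 1) → K)
      (b β : Fin m → K),
      F ∈ rationalFunctionsOver K.toSubfield x y ∧
      (∀ i, h i ∈ rationalFunctionsOver K.toSubfield x y ∧ h i ≠ 0) ∧
      (∀ j, f.eval (β j) ≠ 0) ∧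
      ω = KaehlerDifferential.D k L F
          + ∑ i, (c i : k) • ((h i)⁻¹ • KaehlerDifferential.D k L (h i))
          + ∑ i, (e i : k) • omegaForm k x y (i : ℕ)
          + ∑ j, (b j : k) • nuForm x y (β j : k) := by
  have : CharZero L := charZero_of_injective_algebraMap (algebraMap k L).injective
  have hxy : y ^ 2 = Polynomial.aeval x f := by
    rw [hX.equation, Polynomial.aeval_map_algebraMap]
  have hS : rationalFunctionsOver K.toSubfield x y =
      Subfield.closure (Set.range (algebraMap K L) ∪ {x, y}) := by
    unfold rationalFunctionsOver
    congr 2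
    ext a
    exact ⟨fun ⟨c, hc, h⟩ => ⟨⟨c, hc⟩, h⟩, fun ⟨c, h⟩ => ⟨c, c.2, h⟩⟩
  -- The differentials stay relative to `k`; viewing `D` as a `K`-derivation keeps all constants of
  -- the reduction in `K`.
  obtain ⟨F, n, m, c, h, e, b, β, hF, hh, hβ, heq⟩ := exists_decomposition_of_sq_eq
    ((KaehlerDifferential.D k L).restrictScalars K) hf hd
    (fun h => hX.transcendental (h.tower_top k)) hxy hS hω
  refine ⟨F, n, m, c, h, e, b, β, hF, hh, hβ, heq.trans ?_⟩
  simp only [omegaForm, nuForm, div_eq_mul_inv, ← smul_smul]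
  rfl

/-! ### Descent to the closure of ℚ_p and the integral formula -/

theorem proposition5p1 {p : ℕ} [Fact p.Prime]
    (K : IntermediateField ℚ_[p] ℂ_[p]) [FiniteDimensional ℚ_[p] K]
    (f : Polynomial K) (hf : Squarefree f) (hd : 3 ≤ f.natDegree)
    {L : Type u} [Field L] [Algebra ℂ_[p] L] (x y : L)
    (hX : IsHyperellipticFunctionField (f.map (algebraMap K ℂ_[p])) x y)
    (ω : Ω[L⁄ℂ_[p]]) (hω : ω ∈ meromorphicFormsOver K.toSubfield x y) :
    ∃ (F : L) (n m : ℕ) (c : Fin n → algebraicClosure ℚ_[p] ℂ_[p]) (h : Fin n → L)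
      (e : Fin (f.natDegree - 1) → algebraicClosure ℚ_[p] ℂ_[p])
      (b β : Fin m → algebraicClosure ℚ_[p] ℂ_[p]),
      F ∈ rationalFunctionsOver (algebraicClosure ℚ_[p] ℂ_[p]).toSubfield x y ∧
      (∀ i, h i ∈ rationalFunctionsOver (algebraicClosure ℚ_[p] ℂ_[p]).toSubfield x y ∧
        h i ≠ 0) ∧
      (∀ j, Polynomial.eval (β j : ℂ_[p]) (f.map (algebraMap K ℂ_[p])) ≠ 0) ∧
      ω = KaehlerDifferential.D ℂ_[p] L F
          + ∑ i, (c i : ℂ_[p]) • ((h i)⁻¹ • KaehlerDifferential.D ℂ_[p] L (h i))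
          + ∑ i, (e i : ℂ_[p]) • omegaForm ℂ_[p] x y (i : ℕ)
          + ∑ j, (b j : ℂ_[p]) • nuForm x y (β j : ℂ_[p]) ∧
      ∀ (ℓ : LogBranch p) (I : BerkovichColemanIntegration.{u} p ℓ)
        (U : Opens (BerkPoint ℂ_[p] L)),
        HasNoPoleOn U F → (∀ i, IsUnitOn U (h i)) →
        (∀ i, e i ≠ 0 → IsRegularOn U (omegaForm ℂ_[p] x y (i : ℕ))) →
        (∀ j, IsRegularOn U (nuForm x y (β j : ℂ_[p]))) →
        ∀ {P Q : U} (γ : Path P Q), P.1.IsRational → Q.1.IsRational →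
          I.meromorphicIntegral γ ω =
            (Q.1.eval F - P.1.eval F)
            + ∑ i, (c i : ℂ_[p]) * ℓ.log (Q.1.eval (h i) / P.1.eval (h i))
            + ∑ i, (e i : ℂ_[p]) * I.meromorphicIntegral γ (omegaForm ℂ_[p] x y (i : ℕ))
            + ∑ j, (b j : ℂ_[p]) * I.meromorphicIntegral γ (nuForm x y (β j : ℂ_[p])) := by
  have hle : K ≤ algebraicClosure ℚ_[p] ℂ_[p] := fun a ha =>
    mem_algebraicClosure_iff.mpr
      ((Algebra.IsAlgebraic.isAlgebraic (R := ℚ_[p]) (⟨a, ha⟩ : K)).algebraMap)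
  let φ : K →+* algebraicClosure ℚ_[p] ℂ_[p] := (IntermediateField.inclusion hle).toRingHom
  have hφ : (algebraMap (algebraicClosure ℚ_[p] ℂ_[p]) ℂ_[p]).comp φ = algebraMap K ℂ_[p] := rfl
  have hcl : IsAlgClosed (algebraicClosure ℚ_[p] ℂ_[p]) := IsAlgClosure.isAlgClosed ℚ_[p]
  have hdeg : (f.map φ).natDegree = f.natDegree := Polynomial.natDegree_map φ
  -- Squarefree means separable over a perfect field, and separability survives field extension.
  have hsq : Squarefree (f.map φ) :=
    ((PerfectField.separable_iff_squarefree.mpr hf).map (f := φ)).squarefree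
  have hmap : (f.map φ).map (algebraMap (algebraicClosure ℚ_[p] ℂ_[p]) ℂ_[p]) =
      f.map (algebraMap K ℂ_[p]) := by
    rw [Polynomial.map_map, hφ]
  have hdec := exists_decomposition_of_mem_meromorphicFormsOver
    (algebraicClosure ℚ_[p] ℂ_[p]) (f.map φ) hsq (by omega) x y (by rwa [hmap]) ω
    (meromorphicFormsOver_mono (fun a ha => hle ha) x y hω)
  rw [hdeg] at hdec
  obtain ⟨F, n, m, c, h, e, b, β, hF, hh, hβ, heq⟩ := hdec
  refine ⟨F, n, m, c, h, e, b, β, hF, hh, fun j => ?_, heq, ?_⟩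
  · rw [← hmap, Polynomial.eval_map]
    exact fun h0 => hβ j (Subtype.ext ((Polynomial.eval₂_at_apply
      (algebraMap (algebraicClosure ℚ_[p] ℂ_[p]) ℂ_[p]) (β j)).symm.trans h0))
  intro ℓ I U hFU hhU hωU hνU P Q γ hP hQ
  have hL := hX.isCurveFunctionField
  -- Regularity of every summand with nonzero coefficient on `U` is what allows splitting the
  -- integral.
  have h1 := hFU.isRegularOn_D
  have h2 := fun i (_ : (c i : ℂ_[p]) ≠ 0) => (hhU i).isRegularOn_inv_smul_D (hh i).2
  have h3 := fun i (hi : (e i : ℂ_[p]) ≠ 0) => hωU i (by rintro h0; simp [h0] at hi)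
  have h4 := fun j (_ : (b j : ℂ_[p]) ≠ 0) => hνU j
  have r2 := isRegularOn_sum Finset.univ _ _ h2
  have r3 := isRegularOn_sum Finset.univ _ _ h3
  have r4 := isRegularOn_sum Finset.univ _ _ h4
  rw [heq, I.meromorphicIntegral_add hL γ hP hQ ((h1.add r2).add r3) r4,
    I.meromorphicIntegral_add hL γ hP hQ (h1.add r2) r3,
    I.meromorphicIntegral_add hL γ hP hQ h1 r2,
    I.meromorphicIntegral_sum hL γ hP hQ _ _ _ h2, I.meromorphicIntegral_sum hL γ hP hQ _ _ _ h3,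
    I.meromorphicIntegral_sum hL γ hP hQ _ _ _ h4, I.meromorphicIntegral_D hL γ hP hQ hFU]
  simp only [I.meromorphicIntegral_inv_smul_D hL γ hP hQ (hh _).2 (hhU _)]
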